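/- Work with formal power series in $(x,y_1,y_2)$ over $\mathbb C$. A fibered formal diffeomorphism is a triple $\Phi=(x,\phi_1,\phi_2)$ of formal power series without constant term, with invertible Jacobian matrix at $0$; it acts on formal vector fields by $\Phi_*(Y)=(\mathrm D\Phi\cdot Y)\circ\Phi^{-1}$, and it is tangent to the identity if the components of $\Phi-\mathrm{Id}$ have order at least $2$. A doubly-resonant saddle-node is a formal vector field vanishing at the origin that is conjugate, by a fibered formal diffeomorphism, to a prepared one, i.e. one of the form $$x^2\frac{\partial}{\partial x}+\bigl(-\mu y_1+F_1(x,y_1,y_2)\bigr)\frac{\partial}{\partial y_1}+\bigl(\mu y_2+F_2(x,y_1,y_2)\bigr)\frac{\partial}{\partial y_2},$$ with $\mu\in\mathbb C\setminus\{0\}$ and $F_1,F_2$ of order at least $2$. For a prepared field put $\mathbf A(x)=\bigl(\partial Y_i/\partial y_j(x,0,0)\bigr)_{i,j=1,2}$, where $Y_1,Y_2$ are its components along $\partial/\partial y_1,\partial/\partial y_2$; its residue is $\mathrm{res}(Y)=\bigl(\mathrm{Tr}\,\mathbf A(x)/x\bigr)_{|x=0}$. The residue of a general doubly-resonant saddle-node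 is that of any prepared field conjugate to it by a fibered formal diffeomorphism. $Y$ is non-degenerate if $\mathrm{res}(Y)\in\mathbb C\setminus\mathbb Q_{\le 0}$. **Corollary.** Let $Y$ be a non-degenerate doubly-resonant saddle-node such that $\mathrm D_0Y=\mathrm{diag}(0,-\lambda,\lambda)$ with $\lambda\neq 0$. Then there exists a unique fibered formal diffeomorphism $\Phi$ tangent to the identity such that $$\Phi_*(Y)=x^2\frac{\partial}{\partial x}+\bigl(-\lambda+a_1x+c_1(v)\bigr)y_1\frac{\partial}{\partial y_1}+\bigl(\lambda+a_2x+c_2(v)\bigr)y_2\frac{\partial}{\partial y_2},\qquad v:=y_1y_2,$$ for some formal power series $c_1,c_2\in v\,\mathbb C[[v]]$ and some $a_1,a_2\in\mathbb C$ such that $a_1+a_2=\mathrm{res}(Y)$. -/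

import Mathlib

noncomputable section

namespace SaddleNode

open MvPowerSeries

/-- Formal power series over `ℂ` in `(x, y₁, y₂)`; the variable `x` has index `0`, and `y₁`, `y₂`
have indices `1`, `2`. -/
abbrev Series : Type := MvPowerSeries (Fin 3) ℂ

/-- Triples of formal power series. A triple `Y` is read as the formal vector field
`Y 0 ∂/∂x + Y 1 ∂/∂y₁ + Y 2 ∂/∂y₂`, a triple `Φ` as the formal map `(x, y₁, y₂) ↦ (Φ 0, Φ 1, Φ 2)`. -/
abbrev Triple : Type := Fin 3 → Series

/-- The triple vanishes at the origin. -/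
def VanishesAtOrigin (Y : Triple) : Prop := ∀ i, constantCoeff (Y i) = 0

/-- The Jacobian matrix at the origin. -/
def linearPart (Y : Triple) : Matrix (Fin 3) (Fin 3) ℂ :=
  Matrix.of fun i j => constantCoeff (pderiv ℂ j (Y i))

/-- Formal diffeomorphisms of `ℂ³` fixing the origin. -/
def IsFormalDiffeo (Φ : Triple) : Prop :=
  VanishesAtOrigin Φ ∧ IsUnit (linearPart Φ)

/-- Formal diffeomorphisms fibered in the `x`-coordinate: `(x, y) ↦ (x, φ(x, y))`. -/
def IsFiberedDiffeo (Φ : Triple) : Prop :=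
  IsFormalDiffeo Φ ∧ Φ 0 = X 0

/-- `Φ` is tangent to the identity: every component of `Φ - id` has order at least two. -/
def IsTangentToId (Φ : Triple) : Prop :=
  ∀ i, 2 ≤ (Φ i - X i).order

/-- `Φ_* Y = Z`. By definition `Φ_* Y = (DΦ · Y) ∘ Φ⁻¹`; since `Φ` is invertible, the equality
`Φ_* Y = Z` is the identity `DΦ · Y = Z ∘ Φ` of triples of formal power series. -/
def PushesForwardTo (Φ Y Z : Triple) : Prop :=
  ∀ i, ∑ j, pderiv ℂ j (Φ i) * Y j = (Z i).subst Φ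

/-- `Y` and `Z` are conjugate by a fibered formal diffeomorphism. -/
def FiberedConj (Y Z : Triple) : Prop :=
  ∃ Φ, IsFiberedDiffeo Φ ∧ PushesForwardTo Φ Y Z

/-- Vector fields of the form
`x² ∂/∂x + (-λ y₁ + F₁) ∂/∂y₁ + (λ y₂ + F₂) ∂/∂y₂` with `λ ≠ 0` and `F₁`, `F₂` of order `≥ 2`. -/
def IsPrepared (Y : Triple) : Prop :=
  ∃ (l : ℂ) (F₁ F₂ : Series), l ≠ 0 ∧ 2 ≤ F₁.order ∧ 2 ≤ F₂.order ∧
    Y = ![X 0 ^ 2, -(C l * X 1) + F₁, C l * X 2 + F₂]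

/-- Doubly-resonant saddle-nodes: singular formal vector fields that are conjugate, by a fibered
formal diffeomorphism, to a prepared one. -/
def IsDoublyResonantSaddleNode (Y : Triple) : Prop :=
  VanishesAtOrigin Y ∧ ∃ Z, IsPrepared Z ∧ FiberedConj Y Z

/-- The coefficient of `x` in `Tr A(x)`, where `A(x)` is the `2 × 2` matrix
`(∂Y_i/∂y_j (x, 0, 0))`. If `Y` is prepared then `Tr A(0) = 0` and this is the value of
`Tr A(x) / x` at `x = 0`. -/
def traceCoeff (Y : Triple) : ℂ :=
  coeff (Finsupp.single 0 1) (pderiv ℂ 1 (Y 1) + pderiv ℂ 2 (Y 2))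

open Classical in
/-- The residue of a doubly-resonant saddle-node: it is read off the linear part `A(x)` along
`y = 0` of a prepared form of `Y`, which is `Y` itself if `Y` is already prepared, and is
otherwise a prepared field fibered-conjugate to `Y` (the residue is invariant under fibered
conjugacy of prepared fields, so the choice is immaterial). Junk value `0` outside the class. -/
def residue (Y : Triple) : ℂ :=
  if IsPrepared Y then traceCoeff Y
  else if h : ∃ Z, IsPrepared Z ∧ FiberedConj Y Z then traceCoeff h.choose
  else 0

/-- Non-degenerate doubly-resonant saddle-nodes: the residue is not a rational number `≤ 0`. -/
def IsNonDegenerate (Y : Triple) : Prop :=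
  IsDoublyResonantSaddleNode Y ∧ ¬ ∃ q : ℚ, q ≤ 0 ∧ residue Y = (q : ℂ)

/-- The vector field
`x² ∂/∂x + (-λ + a₁ x + c₁(v)) y₁ ∂/∂y₁ + (λ + a₂ x + c₂(v)) y₂ ∂/∂y₂`, where `v = y₁ y₂`. -/
def normalForm (l a₁ a₂ : ℂ) (c₁ c₂ : PowerSeries ℂ) : Triple :=
  ![X 0 ^ 2,
    (C (-l) + C a₁ * X 0 + c₁.subst (X 1 * X 2 : Series)) * X 1,
    (C l + C a₂ * X 0 + c₂.subst (X 1 * X 2 : Series)) * X 2]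

end SaddleNode

end

noncomputable section

namespace SaddleNode

open MvPowerSeries Finsupp

/-! Fibered conjugacy preserves the `x`-component, so Y₀ = x², and the linear part already makes Y
prepared. Write w = (0, -1, 1). Conjugacy to the normal form then means Y(Φᵢ) = (l wᵢ + aᵢ x +
cᵢ(Φ₁Φ₂)) Φᵢ for i = 1, 2. This is an infinite system in the coefficients of Φᵢ and cᵢ, and it is
triangular with nonzero diagonal, so it has exactly one solution (`existsUnique_of_triangular`,
`system_sub_system`, `diagonal_ne_zero`).

The linear part of Y multiplies the monomial of exponent m by l · `weight m`. If `weight m ≠ wt i`,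
the equation at m determines the coefficient of Φᵢ at m, with factor l (weight m - wᵢ). The resonant
exponents are those of yᵢ xᵖ vᵏ. The equation at yᵢ vᵏ determines the k-th coefficient of cᵢ. The
coefficient of Φᵢ at a resonant n does not appear in the equation at n, but it does one degree
higher, at x times that monomial, with factor n₀ + a₁n₁ + a₂n₂ - aᵢ = p + k (a₁ + a₂).
Non-degeneracy says exactly that this never vanishes for (p, k) ≠ (0, 0). The term n₀ comes from x²
∂/∂x.

The coefficients aᵢ are forced by the equation at x yᵢ (`eq_of_defect_eq_zero`): they are the
coefficients of x yᵢ in Yᵢ, whose sum is the residue. -/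

/-! ### Triangular systems -/

/-- A triangular system of equations with nonzero diagonal has exactly one solution. -/
theorem existsUnique_of_triangular {ι K : Type*} [Field K] (ρ : ι → ℕ) (κ : ι → K)
    (hκ : ∀ i, κ i ≠ 0) (E : (ι → K) → ι → K)
    (h : ∀ i u u', (∀ j, ρ j < ρ i → u j = u' j) → E u i - E u' i = κ i * (u i - u' i)) :
    ∃! u, ∀ i, E u i = 0 := by
  classical
  let wf : WellFounded fun i j : ι => ρ i < ρ j := (measure ρ).wf
  let step : ∀ i, (∀ j, ρ j < ρ i → K) → K := fun i f =>
    -E (fun j => if hj : ρ j < ρ i then f j hj else 0) i / κ i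
  let u : ι → K := wf.fix step
  have hu : ∀ i, u i = -E (fun j => if ρ j < ρ i then u j else 0) i / κ i := by
    intro i
    have := wf.fix_eq step i
    simpa [u, step] using this
  have hE : ∀ i, E u i = 0 := by
    intro i
    -- The truncation of `u` below the rank of `i` vanishes at `i` itself, so the hypothesis
    -- computes `E u i` from the data that defined `u i`.
    have h1 := h i u (fun j => if ρ j < ρ i then u j else 0) (by
      intro j hj
      simp [hj])
    have h2 : κ i * u i = -E (fun j => if ρ j < ρ i then u j else 0) i := by
      rw [hu i]
      field_simp [hκ i]
    simp only [lt_irrefl, if_false, sub_zero, h2] at h1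
    linear_combination h1
  refine ⟨u, hE, fun w hw => ?_⟩
  funext i
  induction i using wf.induction with
  | _ i ih =>
    have h1 := h i w u ih
    rw [hw i, hE, sub_zero, eq_comm, mul_eq_zero, sub_eq_zero] at h1
    exact h1.resolve_left (hκ i)

/-! ### The filtration by order -/

/-- The ideal of power series of order at least `n`. -/
def orderIdeal (n : ℕ) : Ideal Series where
  carrier := {f | ∀ m, degree m < n → coeff m f = 0}
  add_mem' hf hg m hm := by simp [hf m hm, hg m hm]
  zero_mem' m _ := by simp
  smul_mem' g f hf m hm := by
    classical
    rw [smul_eq_mul, coeff_mul]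
    refine Finset.sum_eq_zero fun p hp => ?_
    have h := congrArg degree (Finset.HasAntidiagonal.mem_antidiagonal.1 hp)
    rw [map_add] at h
    rw [hf p.2 (by omega), mul_zero]

theorem mem_orderIdeal {n : ℕ} {f : Series} :
    f ∈ orderIdeal n ↔ ∀ m, degree m < n → coeff m f = 0 := Iff.rfl

theorem mem_orderIdeal_iff_le_order {n : ℕ} {f : Series} :
    f ∈ orderIdeal n ↔ (n : ℕ∞) ≤ f.order := by
  refine ⟨fun h => nat_le_order h, fun h m hm => coeff_of_lt_order ?_⟩
  exact lt_of_lt_of_le (by exact_mod_cast hm) h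

theorem orderIdeal_mono {a b : ℕ} (h : a ≤ b) : orderIdeal b ≤ orderIdeal a :=
  fun _ hf m hm => hf m (hm.trans_le h)

theorem mem_orderIdeal_one {f : Series} : f ∈ orderIdeal 1 ↔ constantCoeff f = 0 := by
  rw [mem_orderIdeal, ← coeff_zero_eq_constantCoeff_apply]
  refine ⟨fun h => h 0 (by simp), fun h m hm => ?_⟩
  have : m = 0 := by rw [← degree_eq_zero_iff]; omega
  rw [this, h]

theorem mem_orderIdeal_zero (f : Series) : f ∈ orderIdeal 0 := fun _ hm => absurd hm (by omega)

theorem mul_mem_orderIdeal {a b : ℕ} {f g : Series} (hf : f ∈ orderIdeal a)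
    (hg : g ∈ orderIdeal b) : f * g ∈ orderIdeal (a + b) := by
  classical
  intro m hm
  rw [coeff_mul]
  refine Finset.sum_eq_zero fun p hp => ?_
  have h := congrArg degree (Finset.HasAntidiagonal.mem_antidiagonal.1 hp)
  rw [map_add] at h
  by_cases h1 : degree p.1 < a
  · rw [hf _ h1, zero_mul]
  · rw [hg p.2 (by omega), mul_zero]

theorem pow_mem_orderIdeal {a : ℕ} {f : Series} (hf : f ∈ orderIdeal a) (k : ℕ) :
    f ^ k ∈ orderIdeal (a * k) := by
  induction k with
  | zero => exact mem_orderIdeal_zero _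
  | succ k ih => rw [pow_succ, mul_add, mul_one]; exact mul_mem_orderIdeal ih hf

theorem X_mem_orderIdeal (i : Fin 3) : (X i : Series) ∈ orderIdeal 1 :=
  mem_orderIdeal_one.2 (by simp)

/-- If `f ≡ f'` and `g ≡ g'` modulo higher order, then so are the products. -/
theorem mul_sub_mul_mem_orderIdeal {a b : ℕ} {f f' g g' : Series} (hf : f ∈ orderIdeal a)
    (hg : g' ∈ orderIdeal b) (hff : f - f' ∈ orderIdeal (a + 1))
    (hgg : g - g' ∈ orderIdeal (b + 1)) : f * g - f' * g' ∈ orderIdeal (a + b + 1) := by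
  have : f * g - f' * g' = f * (g - g') + (f - f') * g' := by ring
  rw [this]
  have h := mul_mem_orderIdeal hf hgg
  rw [← add_assoc] at h
  exact add_mem h
    (add_right_comm a 1 b ▸ mul_mem_orderIdeal hff hg)

theorem pow_sub_pow_mem_orderIdeal {a : ℕ} {f f' : Series} (hf : f ∈ orderIdeal a)
    (hf' : f' ∈ orderIdeal a) (hff : f - f' ∈ orderIdeal (a + 1)) (k : ℕ) :
    f ^ k - f' ^ k ∈ orderIdeal (a * k + 1) := by
  induction k with
  | zero => simp
  | succ k ih =>
    rw [pow_succ, pow_succ, mul_add, mul_one]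
    exact mul_sub_mul_mem_orderIdeal (pow_mem_orderIdeal hf k) hf' ih hff

theorem hasSubst_of_mem_orderIdeal {f : Series} (hf : f ∈ orderIdeal 1) :
    PowerSeries.HasSubst f :=
  PowerSeries.HasSubst.of_constantCoeff_zero (mem_orderIdeal_one.1 hf)

theorem subst_sub_C_mem_orderIdeal {f : Series} (hf : f ∈ orderIdeal 1) (b : PowerSeries ℂ) :
    b.subst f - C (PowerSeries.constantCoeff b) ∈ orderIdeal 1 := by
  rw [mem_orderIdeal_one, map_sub, constantCoeff_C,
    PowerSeries.constantCoeff_subst (hasSubst_of_mem_orderIdeal hf), finsum_eq_single _ 0]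
  · simp
  · intro n hn
    rw [map_pow, mem_orderIdeal_one.1 hf, zero_pow hn, smul_zero]

theorem subst_mem_orderIdeal {n : ℕ} {f : Series} (hn : 1 ≤ n) (hf : f ∈ orderIdeal n)
    {b : PowerSeries ℂ} (hb : PowerSeries.constantCoeff b = 0) : b.subst f ∈ orderIdeal n := by
  have hs := hasSubst_of_mem_orderIdeal (orderIdeal_mono hn hf)
  obtain ⟨b', rfl⟩ := PowerSeries.X_dvd_iff.2 hb
  rw [PowerSeries.subst_mul hs, PowerSeries.subst_X hs]
  exact Ideal.mul_mem_right _ _ hf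

theorem subst_sub_subst_mem_orderIdeal {n : ℕ} {f f' : Series} (hf : f ∈ orderIdeal 1)
    (hf' : f' ∈ orderIdeal 1) (hff : f - f' ∈ orderIdeal n) (b : PowerSeries ℂ) :
    b.subst f - b.subst f' ∈ orderIdeal n := by
  intro m hm
  rw [map_sub, PowerSeries.coeff_subst (hasSubst_of_mem_orderIdeal hf),
    PowerSeries.coeff_subst (hasSubst_of_mem_orderIdeal hf'), sub_eq_zero]
  refine finsum_congr fun k => ?_
  have : f ^ k - f' ^ k ∈ orderIdeal n := Ideal.mem_of_dvd _ (sub_dvd_pow_sub_pow f f' k) hff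
  rw [← sub_eq_zero, ← smul_sub, ← map_sub, this m hm, smul_zero]

/-! ### Action of the vector field on leading coefficients -/

theorem coeff_add_single_X_mul (j : Fin 3) (f : Series) (m : Fin 3 →₀ ℕ) :
    coeff (m + single j 1) (X j * f) = coeff m f := by
  rw [add_comm m, X, coeff_add_monomial_mul, one_mul]

theorem coeff_X_mul_pderiv (j : Fin 3) (f : Series) (m : Fin 3 →₀ ℕ) :
    coeff m (X j * pderiv ℂ j f) = m j * coeff m f := by
  classical
  by_cases hm : m j = 0
  · rw [hm, Nat.cast_zero, zero_mul, X, coeff_monomial_mul, if_neg]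
    intro h
    have := h j
    simp [hm] at this
  · have hle : single j 1 ≤ m := by
      rw [single_le_iff]; omega
    obtain ⟨b, rfl⟩ := exists_add_of_le hle
    rw [X, coeff_add_monomial_mul, one_mul, coeff_pderiv, add_comm b]
    simp [mul_comm, add_comm]

/-- The weights of the coordinates for the resonance `y₁ y₂`. -/
def wt : Fin 3 → ℤ := ![0, -1, 1]

/-- The weight of a monomial: its exponent in `y₂` minus its exponent in `y₁`. -/
def weight (m : Fin 3 →₀ ℕ) : ℤ := m 2 - m 1

theorem weight_add (m n : Fin 3 →₀ ℕ) : weight (m + n) = weight m + weight n := by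
  simp [weight]; ring

theorem weight_single (i : Fin 3) : weight (single i 1) = wt i := by
  fin_cases i <;> simp [weight, wt]

theorem degree_eq (m : Fin 3 →₀ ℕ) : degree m = m 0 + m 1 + m 2 := by
  rw [degree_eq_sum, Fin.sum_univ_three]

/-- The components of `Y` are `l wᵢ Xᵢ + αᵢ x Xᵢ` up to terms of order at least two whose part of
degree two is non-resonant. -/
def HasResonantPart (Y : Triple) (l : ℂ) (α : Fin 3 → ℂ) : Prop :=
  ∃ G : Triple, (∀ i, Y i = C (l * wt i) * X i + C (α i) * (X 0 * X i) + G i) ∧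
    ∀ i m, coeff m (G i) ≠ 0 → 2 ≤ degree m ∧ (degree m = 2 → weight m ≠ wt i)

/-- The operators Xⱼ ∂ⱼ are diagonal on monomials. The linear part therefore acts by the scalar l ·
`weight m`, and the terms αⱼ x Xⱼ by a scalar followed by a shift in x. -/
theorem coeff_derivation_of_remainder {Y G : Triple} {l : ℂ} {α : Fin 3 → ℂ}
    (hY : ∀ i, Y i = C (l * wt i) * X i + C (α i) * (X 0 * X i) + G i) (f : Series)
    (m : Fin 3 →₀ ℕ) (hG : ∀ j, coeff m (pderiv ℂ j f * G j) = 0) :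
    coeff m (∑ j, pderiv ℂ j f * Y j) =
      l * weight m * coeff m f + coeff m (X 0 * ∑ j, C (α j) * (X j * pderiv ℂ j f)) := by
  have : ∑ j, pderiv ℂ j f * Y j = ∑ j, C (l * wt j) * (X j * pderiv ℂ j f) +
      X 0 * ∑ j, C (α j) * (X j * pderiv ℂ j f) + ∑ j, pderiv ℂ j f * G j := by
    rw [Finset.mul_sum, ← Finset.sum_add_distrib, ← Finset.sum_add_distrib]
    refine Finset.sum_congr rfl fun j _ => ?_
    rw [hY j]
    ring
  rw [this, map_add, map_add, map_sum, map_sum (coeff m) (fun j => pderiv ℂ j f * G j),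
    Finset.sum_eq_zero fun j _ => hG j, add_zero]
  simp only [coeff_C_mul, coeff_X_mul_pderiv, Fin.sum_univ_three]
  simp [wt, weight]
  ring

/-- In the leading degree of f only the linear part acts, since all other terms of Y raise the
order. -/
theorem coeff_derivation_of_mem {Y : Triple} {l : ℂ} {α : Fin 3 → ℂ} (hY : HasResonantPart Y l α)
    {f : Series} {m : Fin 3 →₀ ℕ} (hf : f ∈ orderIdeal (degree m)) :
    coeff m (∑ j, pderiv ℂ j f * Y j) = l * weight m * coeff m f := by
  classical
  obtain ⟨G, hY, hG⟩ := hY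
  rw [coeff_derivation_of_remainder hY, add_eq_left]
  · refine mem_orderIdeal.1 (mul_mem_orderIdeal (X_mem_orderIdeal 0) (b := degree m) ?_) m
      (by omega)
    refine Ideal.sum_mem _ fun j _ => Ideal.mul_mem_left _ _ fun n hn => ?_
    rw [coeff_X_mul_pderiv, hf n hn, mul_zero]
  · intro j
    rw [coeff_mul]
    refine Finset.sum_eq_zero fun p hp => ?_
    have h := congrArg degree (Finset.HasAntidiagonal.mem_antidiagonal.1 hp)
    rw [map_add] at h
    by_cases h2 : coeff p.2 (G j) = 0
    · rw [h2, mul_zero]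
    · have := (hG j _ h2).1
      rw [coeff_pderiv, hf _ (by rw [map_add, degree_single]; omega), zero_mul, zero_mul]

/-- One degree above the leading one, a remainder `G j` could contribute only through its quadratic
terms acting on leading terms of f. The latter all have the weight of n, so such a quadratic term
would have weight `wt j`, which `HasResonantPart` excludes. -/
theorem coeff_derivation_of_resonant {Y : Triple} {l : ℂ} {α : Fin 3 → ℂ}
    (hY : HasResonantPart Y l α) {f : Series} {n : Fin 3 →₀ ℕ} (hf : f ∈ orderIdeal (degree n))
    (hw : ∀ b, degree b = degree n → coeff b f ≠ 0 → weight b = weight n) :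
    coeff (n + single 0 1) (∑ j, pderiv ℂ j f * Y j) =
      l * weight n * coeff (n + single 0 1) f + (∑ j, α j * n j) * coeff n f := by
  classical
  obtain ⟨G, hY, hG⟩ := hY
  have hw0 : weight (n + single 0 1) = weight n := by
    rw [weight_add, weight_single]; simp [wt]
  rw [coeff_derivation_of_remainder hY, hw0]
  · congr 1
    rw [coeff_add_single_X_mul, map_sum, Finset.sum_mul]
    refine Finset.sum_congr rfl fun j _ => ?_
    rw [coeff_C_mul, coeff_X_mul_pderiv, mul_assoc]
  · intro j
    rw [coeff_mul]
    refine Finset.sum_eq_zero fun p hp => ?_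
    have h := congrArg degree (Finset.HasAntidiagonal.mem_antidiagonal.1 hp)
    have h' := congrArg weight (Finset.HasAntidiagonal.mem_antidiagonal.1 hp)
    rw [map_add, map_add, degree_single] at h
    rw [hw0, weight_add] at h'
    by_contra hne
    have h2 : coeff p.2 (G j) ≠ 0 := right_ne_zero_of_mul hne
    have h1 : coeff (p.1 + single j 1) f ≠ 0 := by
      have := left_ne_zero_of_mul hne
      rw [coeff_pderiv] at this
      exact left_ne_zero_of_mul this
    obtain ⟨h3, h4⟩ := hG j _ h2
    have h5 : degree n ≤ degree (p.1 + single j 1) := by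
      by_contra hlt
      exact h1 (hf _ (by omega))
    have h6 := h5
    rw [map_add, degree_single] at h6
    have h7 := hw _ (by rw [map_add, degree_single]; omega) h1
    rw [weight_add, weight_single] at h7
    exact h4 (by omega) (by omega)

/-! ### Leading terms of the composed series -/

/-- The exponent of `yᵢ (y₁ y₂) ^ k`. -/
def resonantExponent (i : Fin 3) (k : ℕ) : Fin 3 →₀ ℕ :=
  single i 1 + k • (single 1 1 + single 2 1)

theorem degree_resonantExponent (i : Fin 3) (k : ℕ) :
    degree (resonantExponent i k) = 2 * k + 1 := by
  simp [resonantExponent]; ring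

theorem X_mul_pow_eq_monomial (i : Fin 3) (k : ℕ) :
    (X i * (X 1 * X 2) ^ k : Series) = monomial (resonantExponent i k) 1 := by
  simp only [X, resonantExponent]
  rw [monomial_mul_monomial, monomial_pow, monomial_mul_monomial]
  simp

theorem mem_orderIdeal_one_of_tangent {Φ : Triple} (hΦ : ∀ i, Φ i - X i ∈ orderIdeal 2)
    (i : Fin 3) : Φ i ∈ orderIdeal 1 := by
  have := add_mem (orderIdeal_mono one_le_two (hΦ i)) (X_mem_orderIdeal i)
  rwa [sub_add_cancel] at this

theorem mul_mem_orderIdeal_two {Φ : Triple} (hΦ : ∀ i, Φ i - X i ∈ orderIdeal 2) :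
    Φ 1 * Φ 2 ∈ orderIdeal 2 :=
  mul_mem_orderIdeal (mem_orderIdeal_one_of_tangent hΦ 1) (mem_orderIdeal_one_of_tangent hΦ 2)

/-- The leading term of `e(Φ₁ Φ₂) Φᵢ` when `e` has order at least `K`. -/
theorem coeff_subst_mul_of_X_pow_dvd {Φ : Triple} (hΦ : ∀ i, Φ i - X i ∈ orderIdeal 2)
    {e : PowerSeries ℂ} {K : ℕ} (he : ∀ k < K, PowerSeries.coeff k e = 0) (i : Fin 3)
    {m : Fin 3 →₀ ℕ} (hm : degree m ≤ 2 * K + 1) :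
    coeff m (e.subst (Φ 1 * Φ 2) * Φ i) =
      if m = resonantExponent i K then PowerSeries.coeff K e else 0 := by
  classical
  have hΦ1 := mem_orderIdeal_one_of_tangent hΦ
  have hV := mul_mem_orderIdeal_two hΦ
  have hV1 := orderIdeal_mono one_le_two hV
  have hs := hasSubst_of_mem_orderIdeal hV1
  obtain ⟨b, rfl⟩ := PowerSeries.X_pow_dvd_iff.2 he
  have hb : PowerSeries.coeff K (PowerSeries.X ^ K * b) = PowerSeries.constantCoeff b := by
    simpa using PowerSeries.coeff_X_pow_mul b K 0
  have hX := mul_mem_orderIdeal (X_mem_orderIdeal 1) (X_mem_orderIdeal 2)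
  have hVX : Φ 1 * Φ 2 - X 1 * X 2 ∈ orderIdeal 3 :=
    mul_sub_mul_mem_orderIdeal (hΦ1 1) (X_mem_orderIdeal 2) (hΦ 1) (hΦ 2)
  have h1 : Φ i * (Φ 1 * Φ 2) ^ K - X i * (X 1 * X 2) ^ K ∈ orderIdeal (1 + 2 * K + 1) :=
    mul_sub_mul_mem_orderIdeal (hΦ1 i) (pow_mem_orderIdeal hX K) (hΦ i)
      (pow_sub_pow_mem_orderIdeal hV hX hVX K)
  have h2 : Φ i * (Φ 1 * Φ 2) ^ K * b.subst (Φ 1 * Φ 2) -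
      X i * (X 1 * X 2) ^ K * C (PowerSeries.constantCoeff b) ∈ orderIdeal (1 + 2 * K + 0 + 1) :=
    mul_sub_mul_mem_orderIdeal (a := 1 + 2 * K)
      (mul_mem_orderIdeal (hΦ1 i) (pow_mem_orderIdeal hV K))
      (mem_orderIdeal_zero _) h1 (subst_sub_C_mem_orderIdeal hV1 b)
  have h3 := h2 m (by omega)
  rw [map_sub, sub_eq_zero] at h3
  rw [PowerSeries.subst_mul hs, PowerSeries.subst_pow hs, PowerSeries.subst_X hs, hb,
    mul_right_comm, mul_comm _ (Φ i), h3, X_mul_pow_eq_monomial, coeff_mul_C, coeff_monomial]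
  split_ifs <;> simp

/-- Comparison of the terms `cᵢ(Φ₁ Φ₂) Φᵢ` for two candidates that agree to low order. -/
theorem coeff_subst_mul_sub {Φ Φ' : Triple} (hΦ : ∀ i, Φ i - X i ∈ orderIdeal 2)
    (hΦ' : ∀ i, Φ' i - X i ∈ orderIdeal 2) {c c' : PowerSeries ℂ}
    (hc : PowerSeries.constantCoeff c = 0) {K e : ℕ}
    (he : ∀ k < K, PowerSeries.coeff k c = PowerSeries.coeff k c')
    (hd : ∀ j, Φ j - Φ' j ∈ orderIdeal e) (i : Fin 3)
    {m : Fin 3 →₀ ℕ} (hm : degree m ≤ 2 * K + 1) (hme : degree m ≤ e + 1) :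
    coeff m (c.subst (Φ 1 * Φ 2) * Φ i) - coeff m (c'.subst (Φ' 1 * Φ' 2) * Φ' i) =
      if m = resonantExponent i K then PowerSeries.coeff K c - PowerSeries.coeff K c' else 0 := by
  have hΦ1 := mem_orderIdeal_one_of_tangent hΦ
  have hΦ1' := mem_orderIdeal_one_of_tangent hΦ'
  have hV := mul_mem_orderIdeal_two hΦ
  have hV1 := orderIdeal_mono one_le_two hV
  have hV1' := orderIdeal_mono one_le_two (mul_mem_orderIdeal_two hΦ')
  have hVV : Φ 1 * Φ 2 - Φ' 1 * Φ' 2 ∈ orderIdeal (1 + e) := by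
    have : Φ 1 * Φ 2 - Φ' 1 * Φ' 2 = Φ 1 * (Φ 2 - Φ' 2) + Φ' 2 * (Φ 1 - Φ' 1) := by ring
    rw [this]
    exact add_mem (mul_mem_orderIdeal (hΦ1 1) (hd 2)) (mul_mem_orderIdeal (hΦ1' 2) (hd 1))
  -- With V = Φ₁Φ₂ and V' = Φ'₁Φ'₂, the difference is c(V)(Φᵢ - Φ'ᵢ) + (c(V) - c(V'))Φ'ᵢ + (c -
  -- c')(V')Φ'ᵢ. The first two terms have order at least e + 2, the first because c has no constant
  -- term.
  have h1 := mul_mem_orderIdeal (subst_mem_orderIdeal one_le_two hV hc) (hd i) m (by omega)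
  have h2 := mul_mem_orderIdeal (subst_sub_subst_mem_orderIdeal hV1 hV1' hVV c) (hΦ1' i) m
    (by omega)
  have h3 := coeff_subst_mul_of_X_pow_dvd hΦ' (e := c - c') (K := K)
    (fun k hk => by rw [map_sub, he k hk, sub_self]) i hm
  rw [PowerSeries.subst_sub (hasSubst_of_mem_orderIdeal hV1')] at h3
  rw [map_sub (PowerSeries.coeff K)] at h3
  rw [← h3, ← map_sub, ← sub_eq_zero, ← map_sub]
  rw [← zero_add (0 : ℂ)]
  nth_rewrite 1 [← h1]
  rw [← h2, ← map_add]
  congr 1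
  ring

/-! ### The defect of a candidate and its leading variation -/

/-- The failure of `Φᵢ` to satisfy `Y(Φᵢ) = (l wᵢ + aᵢ x + cᵢ(Φ₁ Φ₂)) Φᵢ`. -/
def defect (Y : Triple) (l : ℂ) (a : Fin 3 → ℂ) (Φ : Triple) (c : Fin 3 → PowerSeries ℂ)
    (i : Fin 3) : Series :=
  ∑ j, pderiv ℂ j (Φ i) * Y j -
    (C (l * wt i) + C (a i) * X 0 + (c i).subst (Φ 1 * Φ 2)) * Φ i

theorem defect_sub_defect (Y : Triple) (l : ℂ) (a : Fin 3 → ℂ) (Φ Φ' : Triple)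
    (c c' : Fin 3 → PowerSeries ℂ) (i : Fin 3) :
    defect Y l a Φ c i - defect Y l a Φ' c' i =
      ∑ j, pderiv ℂ j (Φ i - Φ' i) * Y j - C (l * wt i) * (Φ i - Φ' i) -
        C (a i) * (X 0 * (Φ i - Φ' i)) -
        ((c i).subst (Φ 1 * Φ 2) * Φ i - (c' i).subst (Φ' 1 * Φ' 2) * Φ' i) := by
  simp only [defect, map_sub, sub_mul, Finset.sum_sub_distrib]
  ring

/-- To leading order the variation of the defect is that of the linear part of Y, apart from the
first free coefficient of cᵢ, which appears only at yᵢ vᴷ. -/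
theorem coeff_defect_sub_of_mem {Y : Triple} {l : ℂ} {α : Fin 3 → ℂ}
    (hY : HasResonantPart Y l α) (a : Fin 3 → ℂ) {Φ Φ' : Triple}
    (hΦ : ∀ i, Φ i - X i ∈ orderIdeal 2) (hΦ' : ∀ i, Φ' i - X i ∈ orderIdeal 2)
    {c c' : Fin 3 → PowerSeries ℂ} {i : Fin 3} (hc : PowerSeries.constantCoeff (c i) = 0) {K : ℕ}
    (he : ∀ k < K, PowerSeries.coeff k (c i) = PowerSeries.coeff k (c' i))
    {m : Fin 3 →₀ ℕ} (hd : ∀ j, Φ j - Φ' j ∈ orderIdeal (degree m)) (hm : degree m ≤ 2 * K + 1) :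
    coeff m (defect Y l a Φ c i) - coeff m (defect Y l a Φ' c' i) =
      l * (weight m - wt i : ℤ) * coeff m (Φ i - Φ' i) -
      if m = resonantExponent i K then
        PowerSeries.coeff K (c i) - PowerSeries.coeff K (c' i) else 0 := by
  rw [← map_sub, defect_sub_defect, map_sub, map_sub, map_sub, coeff_derivation_of_mem hY (hd i),
    coeff_C_mul, coeff_C_mul,
    mul_mem_orderIdeal (X_mem_orderIdeal 0) (hd i) m (by omega), map_sub _ (_ * _),
    coeff_subst_mul_sub hΦ hΦ' hc he hd i hm (by omega)]
  push_cast
  ring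

/-- At x times a resonant monomial the coefficient of Φᵢ of that same degree cancels against l wᵢ
Φᵢ, and the K-th coefficient of cᵢ is absent because yᵢ vᴷ contains no x. What survives is the
coefficient of Φᵢ one degree lower. -/
theorem coeff_defect_sub_of_resonant {Y : Triple} {l : ℂ} {α : Fin 3 → ℂ}
    (hY : HasResonantPart Y l α) (a : Fin 3 → ℂ) {Φ Φ' : Triple}
    (hΦ : ∀ i, Φ i - X i ∈ orderIdeal 2) (hΦ' : ∀ i, Φ' i - X i ∈ orderIdeal 2)
    {c c' : Fin 3 → PowerSeries ℂ} {i : Fin 3} (hi : i ≠ 0)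
    (hc : PowerSeries.constantCoeff (c i) = 0) {K : ℕ}
    (he : ∀ k < K, PowerSeries.coeff k (c i) = PowerSeries.coeff k (c' i))
    {n : Fin 3 →₀ ℕ} (hd : ∀ j, Φ j - Φ' j ∈ orderIdeal (degree n)) (hn : degree n ≤ 2 * K)
    (hni : weight n = wt i)
    (hw : ∀ b, degree b = degree n → coeff b (Φ i - Φ' i) ≠ 0 → weight b = wt i) :
    coeff (n + single 0 1) (defect Y l a Φ c i) - coeff (n + single 0 1) (defect Y l a Φ' c' i) =
      (∑ j, α j * n j - a i) * coeff n (Φ i - Φ' i) := by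
  have hne : n + single 0 1 ≠ resonantExponent i K := by
    intro h
    have := DFunLike.congr_fun h 0
    simp [resonantExponent, hi] at this
  have hdeg : degree (n + single 0 1) = degree n + 1 := by simp
  rw [← map_sub, defect_sub_defect, map_sub, map_sub, map_sub,
    coeff_derivation_of_resonant hY (hd i) (fun b hb hb' => by rw [hw b hb hb', hni]),
    coeff_C_mul, coeff_C_mul, coeff_add_single_X_mul, map_sub _ (_ * _),
    coeff_subst_mul_sub hΦ hΦ' hc he hd i (by omega) (by omega), if_neg hne, hni]
  ring

/-- In low degree the equations only involve the linear terms and the coefficient of `x yᵢ`. -/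
theorem coeff_defect_of_degree_le_two {Y : Triple} {l : ℂ} {α : Fin 3 → ℂ}
    (hY : HasResonantPart Y l α) (a : Fin 3 → ℂ) {Φ : Triple}
    (hΦ : ∀ i, Φ i - X i ∈ orderIdeal 2) {c : Fin 3 → PowerSeries ℂ} {i : Fin 3}
    (hc : PowerSeries.constantCoeff (c i) = 0) {m : Fin 3 →₀ ℕ} (hm : degree m ≤ 2)
    (hw : degree m = 2 → weight m = wt i) :
    coeff m (defect Y l a Φ c i) = (α i - a i) * coeff m (X 0 * X i : Series) := by
  have hX : ∀ i, (X : Fin 3 → Series) i - X i ∈ orderIdeal 2 := fun i => by simp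
  -- The comparison is with the identity map and c = 0. `K := 1` suffices because the constant terms
  -- vanish and y v has degree 3.
  have h := coeff_defect_sub_of_mem hY a hΦ hX (c := c) (c' := fun _ => 0) (K := 1) (i := i) hc
    (fun k hk => by simpa [Nat.lt_one_iff.1 hk] using hc)
    (fun j => orderIdeal_mono hm (hΦ j)) (by omega)
  have h1 : m ≠ resonantExponent i 1 := fun h => by
    have := congrArg degree h
    rw [degree_resonantExponent] at this
    omega
  have h2 : l * ((weight m - wt i : ℤ) : ℂ) * coeff m (Φ i - X i) = 0 := by
    by_cases h2 : degree m = 2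
    · rw [hw h2, sub_self, Int.cast_zero, mul_zero, zero_mul]
    · rw [hΦ i m (by omega), mul_zero]
  rw [if_neg h1, h2, sub_zero, sub_eq_zero] at h
  obtain ⟨G, hYG, hG⟩ := hY
  have h3 : coeff m (G i) = 0 := by
    by_contra h3
    obtain ⟨h4, h5⟩ := hG i m h3
    exact h5 (by omega) (hw (by omega))
  have h4 : defect Y l a X (fun _ => 0) i = C (α i - a i) * (X 0 * X i) + G i := by
    have h5 : (0 : PowerSeries ℂ).subst (X 1 * X 2 : Series) = 0 := by
      have hs := hasSubst_of_mem_orderIdeal (orderIdeal_mono one_le_two (mul_mem_orderIdeal_two hX))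
      rw [← PowerSeries.coe_substAlgHom hs, map_zero]
    have h6 : ∑ j, pderiv ℂ j (X i : Series) * Y j = Y i := by
      rw [Finset.sum_eq_single i]
      · rw [pderiv_X_self, one_mul]
      · intro j _ hj
        rw [pderiv_X_of_ne hj.symm, zero_mul]
      · simp
    rw [defect, h6, h5, hYG i, map_sub]
    ring
  rw [h, h4, map_add, coeff_C_mul, h3, add_zero]

/-! ### The triangular system and its solution -/

/-- The unknowns: the coefficients of the maps `Φᵢ` and those of the series `cᵢ`. -/
abbrev Unknown : Type := Fin 3 × ((Fin 3 →₀ ℕ) ⊕ ℕ)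

/-- The map tangent to the identity, fibered in `x`, with prescribed coefficients. -/
def toMap (u : Unknown → ℂ) : Triple := fun i n =>
  if i = 0 ∨ degree n < 2 then coeff n (X i : Series) else u (i, Sum.inl n)

/-- The power series without constant term with prescribed coefficients. -/
def toSeries (u : Unknown → ℂ) (i : Fin 3) : PowerSeries ℂ :=
  PowerSeries.mk fun k => if k = 0 then 0 else u (i, Sum.inr k)

theorem coeff_toMap (u : Unknown → ℂ) (i : Fin 3) (n : Fin 3 →₀ ℕ) :
    coeff n (toMap u i) =
      if i = 0 ∨ degree n < 2 then coeff n (X i : Series) else u (i, Sum.inl n) := rfl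

theorem toMap_zero (u : Unknown → ℂ) : toMap u 0 = X 0 := by
  ext n
  simp [coeff_toMap]

theorem toMap_sub_X_mem (u : Unknown → ℂ) (i : Fin 3) : toMap u i - X i ∈ orderIdeal 2 := by
  intro m hm
  rw [map_sub, coeff_toMap, if_pos (Or.inr hm), sub_self]

theorem constantCoeff_toSeries (u : Unknown → ℂ) (i : Fin 3) :
    PowerSeries.constantCoeff (toSeries u i) = 0 := by
  rw [← PowerSeries.coeff_zero_eq_constantCoeff_apply, toSeries, PowerSeries.coeff_mk, if_pos rfl]

/-- The equations, indexed by the unknown that each of them determines. -/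
def system (Y : Triple) (l : ℂ) (a : Fin 3 → ℂ) (u : Unknown → ℂ) : Unknown → ℂ
  | (i, Sum.inl n) =>
    if i = 0 ∨ degree n < 2 then u (i, Sum.inl n)
    else if weight n = wt i then coeff (n + single 0 1) (defect Y l a (toMap u) (toSeries u) i)
    else coeff n (defect Y l a (toMap u) (toSeries u) i)
  | (i, Sum.inr k) =>
    if i = 0 ∨ k = 0 then u (i, Sum.inr k)
    else coeff (resonantExponent i k) (defect Y l a (toMap u) (toSeries u) i)

/-- The order in which the unknowns are determined. -/
def rank : Unknown → ℕ
  | (i, Sum.inl n) => if weight n = wt i then 3 * degree n + 1 else 3 * degree n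
  | (_, Sum.inr k) => 6 * k + 2

/-- The diagonal coefficients of the system. -/
def diagonal (l : ℂ) (a : Fin 3 → ℂ) : Unknown → ℂ
  | (i, Sum.inl n) =>
    if i = 0 ∨ degree n < 2 then 1
    else if weight n = wt i then ∑ j, a j * n j - a i else l * (weight n - wt i : ℤ)
  | (i, Sum.inr k) => if i = 0 ∨ k = 0 then 1 else -1

/-- A resonant n for i has the form eᵢ + p e₀ + k (e₁ + e₂), with diagonal entry p + k (a₁ + a₂).
Here p + k ≠ 0 since n has degree at least 2. If the entry vanishes, then k ≠ 0 and a₁ + a₂ = -p/k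
is a nonpositive rational. -/
theorem diagonal_ne_zero {l : ℂ} (hl : l ≠ 0) {a : Fin 3 → ℂ} (ha0 : a 0 = 1)
    (ha : ¬ ∃ q : ℚ, q ≤ 0 ∧ a 1 + a 2 = (q : ℂ)) (s : Unknown) : diagonal l a s ≠ 0 := by
  have key : ∀ p k : ℕ, p + k ≠ 0 → (p : ℂ) + (a 1 + a 2) * k ≠ 0 := by
    intro p k hpk h
    by_cases hk : k = 0
    · subst hk
      simp at h
      omega
    · refine ha ⟨-(p / k : ℚ), by rw [neg_nonpos]; positivity, ?_⟩
      have : (k : ℂ) ≠ 0 := by exact_mod_cast hk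
      push_cast
      field_simp
      linear_combination h
  obtain ⟨i, n | k⟩ := s
  · simp only [diagonal]
    split_ifs with h1 h2
    · exact one_ne_zero
    · push Not at h1
      obtain ⟨hi, hn⟩ := h1
      rw [degree_eq] at hn
      rw [Fin.sum_univ_three, ha0]
      have hi' : i = 1 ∨ i = 2 := by fin_cases i <;> simp at hi ⊢
      rcases hi' with rfl | rfl
      · have h3 : n 1 = n 2 + 1 := by simp [weight, wt] at h2; omega
        have := key (n 0) (n 2) (by omega)
        rw [h3]
        push_cast
        intro h
        exact this (by linear_combination h)
      · have h3 : n 2 = n 1 + 1 := by simp [weight, wt] at h2; omega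
        have := key (n 0) (n 1) (by omega)
        rw [h3]
        push_cast
        intro h
        exact this (by linear_combination h)
    · exact mul_ne_zero hl (Int.cast_ne_zero.2 (sub_ne_zero.2 h2))
  · simp only [diagonal]
    split_ifs <;> simp

theorem toMap_sub_toMap_mem {u u' : Unknown → ℂ} {d : ℕ}
    (h : ∀ j n, degree n < d → u (j, Sum.inl n) = u' (j, Sum.inl n)) (j : Fin 3) :
    toMap u j - toMap u' j ∈ orderIdeal d := by
  intro n hn
  rw [map_sub, coeff_toMap, coeff_toMap, h j n hn, sub_self]

theorem coeff_toSeries_congr {u u' : Unknown → ℂ} {i : Fin 3} {k : ℕ}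
    (h : u (i, Sum.inr k) = u' (i, Sum.inr k)) :
    PowerSeries.coeff k (toSeries u i) = PowerSeries.coeff k (toSeries u' i) := by
  simp [toSeries, h]

theorem rank_inl_le (i : Fin 3) (n : Fin 3 →₀ ℕ) : rank (i, Sum.inl n) ≤ 3 * degree n + 1 := by
  simp only [rank]
  split_ifs <;> omega

/-- This is where the values of `rank` matter. In degree d the non-resonant coefficients of Φ (rank
3d) precede the resonant ones (rank 3d + 1), whose equation lies in degree d + 1 and still involves
the former. The k-th coefficient of cᵢ is read in degree 2k + 1 and needs Φ only up to degree 2k,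
that is, up to rank 6k + 1. -/
theorem system_sub_system {Y : Triple} {l : ℂ} {a : Fin 3 → ℂ} (hY : HasResonantPart Y l a)
    (s : Unknown) (u u' : Unknown → ℂ) (h : ∀ t, rank t < rank s → u t = u' t) :
    system Y l a u s - system Y l a u' s = diagonal l a s * (u s - u' s) := by
  have hΦ := toMap_sub_X_mem u
  have hΦ' := toMap_sub_X_mem u'
  obtain ⟨i, n | k⟩ := s
  · have hd : ∀ j, toMap u j - toMap u' j ∈ orderIdeal (degree n) := by
      refine toMap_sub_toMap_mem fun j b hb => h _ ?_
      have := rank_inl_le j b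
      have : 3 * degree n ≤ rank (i, Sum.inl n) := by simp only [rank]; split_ifs <;> omega
      omega
    simp only [system, diagonal]
    split_ifs with h1 h2
    · rw [one_mul]
    · have hδ : coeff n (toMap u i - toMap u' i) = u (i, Sum.inl n) - u' (i, Sum.inl n) := by
        rw [map_sub, coeff_toMap, coeff_toMap, if_neg h1, if_neg h1]
      push Not at h1
      -- This `K` is the least with `degree n ≤ 2 * K`, so that only coefficients of cᵢ of lower
      -- rank have to agree.
      rw [coeff_defect_sub_of_resonant hY a hΦ hΦ' h1.1 (constantCoeff_toSeries u i)
        (K := (degree n + 1) / 2) _ hd (by omega) h2, hδ]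
      · intro b hb hb'
        by_contra hbw
        refine hb' ?_
        rw [map_sub, coeff_toMap, coeff_toMap, h (i, Sum.inl b), sub_self]
        simp only [rank, if_neg hbw, if_pos h2, hb]
        omega
      · intro k hk
        refine coeff_toSeries_congr (h _ ?_)
        simp only [rank, if_pos h2]
        omega
    · have hδ : coeff n (toMap u i - toMap u' i) = u (i, Sum.inl n) - u' (i, Sum.inl n) := by
        rw [map_sub, coeff_toMap, coeff_toMap, if_neg h1, if_neg h1]
      -- This `K` is the least with `degree n ≤ 2 * K + 1`. Its own coefficient drops out because n
      -- is not resonant.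
      rw [coeff_defect_sub_of_mem hY a hΦ hΦ' (constantCoeff_toSeries u i)
        (K := degree n / 2) _ hd (by omega), hδ, if_neg, sub_zero]
      · intro hn
        apply h2
        rw [hn, resonantExponent]
        simp [weight, wt]
        fin_cases i <;> simp
      · intro k hk
        refine coeff_toSeries_congr (h _ ?_)
        simp only [rank, if_neg h2]
        omega
  · simp only [system, diagonal]
    split_ifs with h1
    · rw [one_mul]
    · have hdeg := degree_resonantExponent i k
      push Not at h1
      have hd : ∀ j, toMap u j - toMap u' j ∈ orderIdeal (degree (resonantExponent i k)) := by
        refine toMap_sub_toMap_mem fun j b hb => h _ ?_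
        have := rank_inl_le j b
        simp only [rank] at this ⊢
        omega
      have hw : weight (resonantExponent i k) = wt i := by
        rw [resonantExponent]
        simp [weight, wt]
        fin_cases i <;> simp
      rw [coeff_defect_sub_of_mem hY a hΦ hΦ' (constantCoeff_toSeries u i)
        (K := k) _ hd (by omega), if_pos rfl, hw]
      · simp [toSeries, h1.2]
      · intro k' hk
        refine coeff_toSeries_congr (h _ ?_)
        simp only [rank]
        omega

theorem existsUnique_system {Y : Triple} {l : ℂ} (hl : l ≠ 0) {a : Fin 3 → ℂ}
    (hY : HasResonantPart Y l a) (ha0 : a 0 = 1)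
    (ha : ¬ ∃ q : ℚ, q ≤ 0 ∧ a 1 + a 2 = (q : ℂ)) : ∃! u, ∀ s, system Y l a u s = 0 :=
  existsUnique_of_triangular rank (diagonal l a) (diagonal_ne_zero hl ha0 ha) (system Y l a)
    fun s u u' h => system_sub_system hY s u u' h

theorem eq_resonantExponent {i : Fin 3} (hi : i ≠ 0) {m : Fin 3 →₀ ℕ} (hw : weight m = wt i)
    (hm : m 0 = 0) : m = resonantExponent i (min (m 1) (m 2)) := by
  have hi' : i = 1 ∨ i = 2 := by fin_cases i <;> simp at hi ⊢
  rcases hi' with rfl | rfl <;> simp [weight, wt] at hw <;> ext j <;> fin_cases j <;>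
    simp [resonantExponent, hm] <;> omega

/-- Each coefficient of the defect is either one of the equations or vanishes by the low-degree
computation, where aᵢ has the value read off from Y. -/
theorem defect_eq_zero_of_system {Y : Triple} {l : ℂ} {a : Fin 3 → ℂ}
    (hY : HasResonantPart Y l a) {u : Unknown → ℂ} (hu : ∀ s, system Y l a u s = 0) {i : Fin 3}
    (hi : i ≠ 0) : defect Y l a (toMap u) (toSeries u) i = 0 := by
  ext m
  rw [map_zero]
  by_cases hlow : degree m ≤ 2 ∧ (degree m = 2 → weight m = wt i)
  · rw [coeff_defect_of_degree_le_two hY a (toMap_sub_X_mem u) (constantCoeff_toSeries u i)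
      hlow.1 hlow.2, sub_self, zero_mul]
  · have h2 : 2 ≤ degree m := by
      by_contra h2
      exact hlow ⟨by omega, by omega⟩
    by_cases hw : weight m = wt i
    · by_cases hm : m 0 = 0
      · have h3 := eq_resonantExponent hi hw hm
        have h4 := congrArg degree h3
        rw [degree_resonantExponent] at h4
        have := hu (i, Sum.inr (min (m 1) (m 2)))
        simp only [system] at this
        rwa [if_neg (by rw [not_or]; exact ⟨hi, by omega⟩), ← h3] at this
      · obtain ⟨n, rfl⟩ : ∃ n, m = n + single 0 1 := by
          have hle : single 0 1 ≤ m := by rw [single_le_iff]; omega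
          obtain ⟨n, hn⟩ := exists_add_of_le hle
          exact ⟨n, by rw [hn, add_comm]⟩
        have hwn : weight n = wt i := by
          rw [weight_add, weight_single] at hw
          simpa [wt] using hw
        have hn : 2 ≤ degree n := by
          rw [map_add, degree_single] at hlow h2
          by_contra hn
          exact hlow ⟨by omega, fun _ => hw⟩
        have := hu (i, Sum.inl n)
        simp only [system] at this
        rwa [if_neg (by rw [not_or]; exact ⟨hi, by omega⟩), if_pos hwn] at this
    · have := hu (i, Sum.inl m)
      simp only [system] at this
      rwa [if_neg (by rw [not_or]; exact ⟨hi, by omega⟩), if_neg hw] at this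

/-- The unknowns that `toMap` and `toSeries` ignore are set to 0, as their placeholder equations
demand. Uniqueness of the solution of the system thus carries over to Φ. -/
theorem exists_system_of_defect_eq_zero {Y : Triple} {l : ℂ} {a : Fin 3 → ℂ} {Φ : Triple}
    (hΦ : ∀ i, Φ i - X i ∈ orderIdeal 2) (hΦ0 : Φ 0 = X 0) {c : Fin 3 → PowerSeries ℂ}
    (hc : ∀ i, PowerSeries.constantCoeff (c i) = 0)
    (h : ∀ i, i ≠ 0 → defect Y l a Φ c i = 0) :
    ∃ u, (∀ s, system Y l a u s = 0) ∧ toMap u = Φ := by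
  let u : Unknown → ℂ := fun s => match s with
    | (i, Sum.inl n) => if i = 0 ∨ degree n < 2 then 0 else coeff n (Φ i)
    | (i, Sum.inr k) => if i = 0 ∨ k = 0 then 0 else PowerSeries.coeff k (c i)
  have hu : toMap u = Φ := by
    funext i
    ext n
    rw [coeff_toMap]
    split_ifs with h1
    · rcases h1 with rfl | h1
      · rw [hΦ0]
      · have := hΦ i n h1
        rw [map_sub, sub_eq_zero] at this
        exact this.symm
    · simp only [u, if_neg h1]
  have huc : ∀ i, i ≠ 0 → toSeries u i = c i := by
    intro i hi
    ext k
    simp only [toSeries, PowerSeries.coeff_mk, u, hi, false_or]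
    split_ifs with h1
    · rw [h1, PowerSeries.coeff_zero_eq_constantCoeff_apply, hc]
    · rfl
  have hdef : ∀ i, i ≠ 0 → defect Y l a (toMap u) (toSeries u) i = 0 := by
    intro i hi
    have := h i hi
    rw [defect] at this ⊢
    rw [huc i hi, hu, this]
  refine ⟨u, ?_, hu⟩
  rintro ⟨i, n | k⟩
  · simp only [system]
    split_ifs with h1 h2
    · simp only [u, if_pos h1]
    · rw [hdef i (not_or.1 h1).1, map_zero]
    · rw [hdef i (not_or.1 h1).1, map_zero]
  · simp only [system]
    split_ifs with h1
    · simp only [u, if_pos h1]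
    · rw [hdef i (not_or.1 h1).1, map_zero]

/-! ### Translation to conjugacy and to the data of the saddle-node -/

/-- The coefficients `aᵢ` of a normal form are determined by `Y`. -/
theorem eq_of_defect_eq_zero {Y : Triple} {l : ℂ} {α a : Fin 3 → ℂ}
    (hY : HasResonantPart Y l α) {Φ : Triple} (hΦ : ∀ i, Φ i - X i ∈ orderIdeal 2)
    {c : Fin 3 → PowerSeries ℂ} {i : Fin 3} (hc : PowerSeries.constantCoeff (c i) = 0)
    (h : defect Y l a Φ c i = 0) : a i = α i := by
  have h1 := coeff_defect_of_degree_le_two hY a hΦ hc (m := single i 1 + single 0 1)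
    (by simp) (fun _ => by rw [weight_add, weight_single, weight_single]; simp [wt])
  rw [h, map_zero, coeff_add_single_X_mul, coeff_index_single_self_X, mul_one, eq_comm,
    sub_eq_zero] at h1
  exact h1.symm

/-- Composition with Φ fixes x and turns v into Φ₁Φ₂. The x-component of the conjugacy equation
reads x² = x², so only the two y-components remain. -/
theorem pushesForwardTo_normalForm_iff {Y : Triple} (hY0 : Y 0 = X 0 ^ 2) {l a₁ a₂ : ℂ}
    {c₁ c₂ : PowerSeries ℂ} {Φ : Triple} (hΦ : ∀ i, Φ i - X i ∈ orderIdeal 2)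
    (hΦ0 : Φ 0 = X 0) :
    PushesForwardTo Φ Y (normalForm l a₁ a₂ c₁ c₂) ↔
      ∀ i, i ≠ 0 → defect Y l ![1, a₁, a₂] Φ ![0, c₁, c₂] i = 0 := by
  have hs : HasSubst Φ := hasSubst_of_constantCoeff_zero fun i =>
    mem_orderIdeal_one.1 (mem_orderIdeal_one_of_tangent hΦ i)
  have hX : PowerSeries.HasSubst (X 1 * X 2 : Series) :=
    PowerSeries.HasSubst.of_constantCoeff_zero (by simp)
  have hcomp : ∀ c : PowerSeries ℂ,
      subst Φ (c.subst (X 1 * X 2 : Series)) = c.subst (Φ 1 * Φ 2) := by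
    intro c
    rw [PowerSeries.subst_def, subst_comp_subst_apply hX.const hs, PowerSeries.subst_def]
    congr 1
    funext _
    rw [subst_mul hs, subst_X hs, subst_X hs]
  have h0 : ∑ j, pderiv ℂ j (Φ 0) * Y j = (normalForm l a₁ a₂ c₁ c₂ 0).subst Φ := by
    have h1 : normalForm l a₁ a₂ c₁ c₂ 0 = X 0 ^ 2 := rfl
    rw [h1, subst_pow hs, subst_X hs, hΦ0, Fin.sum_univ_three, pderiv_X_self,
      pderiv_X_of_ne (by decide), pderiv_X_of_ne (by decide), hY0]
    ring
  have h12 : ∀ b a (c : PowerSeries ℂ) i, subst Φ ((C b + C a * X 0 +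
      c.subst (X 1 * X 2 : Series)) * X i : Series) =
      (C b + C a * X 0 + c.subst (Φ 1 * Φ 2)) * Φ i := by
    intro b a c i
    rw [subst_mul hs, subst_add hs, subst_add hs, subst_mul hs, subst_X hs, subst_X hs,
      subst_C, subst_C, hcomp, hΦ0]
  have h1 : (normalForm l a₁ a₂ c₁ c₂ 1).subst Φ =
      (C (-l) + C a₁ * X 0 + c₁.subst (Φ 1 * Φ 2)) * Φ 1 := h12 _ _ _ _
  have h2 : (normalForm l a₁ a₂ c₁ c₂ 2).subst Φ =
      (C l + C a₂ * X 0 + c₂.subst (Φ 1 * Φ 2)) * Φ 2 := h12 _ _ _ _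
  have hd1 : defect Y l ![1, a₁, a₂] Φ ![0, c₁, c₂] 1 = 0 ↔
      ∑ j, pderiv ℂ j (Φ 1) * Y j = (normalForm l a₁ a₂ c₁ c₂ 1).subst Φ := by
    rw [h1, defect, sub_eq_zero]
    simp [wt]
  have hd2 : defect Y l ![1, a₁, a₂] Φ ![0, c₁, c₂] 2 = 0 ↔
      ∑ j, pderiv ℂ j (Φ 2) * Y j = (normalForm l a₁ a₂ c₁ c₂ 2).subst Φ := by
    rw [h2, defect, sub_eq_zero]
    simp [wt]
  rw [PushesForwardTo, Fin.forall_fin_succ, Fin.forall_fin_two, Fin.forall_fin_succ,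
    Fin.forall_fin_two]
  simp only [Fin.succ_zero_eq_one, Fin.succ_one_eq_two, ne_eq, not_true, false_imp_iff,
    true_and, one_ne_zero, not_false_eq_true, true_imp_iff]
  rw [hd1, hd2]
  simp [h0]

theorem isTangentToId_iff {Φ : Triple} :
    IsTangentToId Φ ↔ ∀ i, Φ i - X i ∈ orderIdeal 2 :=
  forall_congr' fun _ => mem_orderIdeal_iff_le_order.symm

theorem linearPart_apply (Y : Triple) (i j : Fin 3) :
    linearPart Y i j = coeff (single j 1) (Y i) := by
  rw [linearPart, Matrix.of_apply, ← coeff_zero_eq_constantCoeff_apply, coeff_pderiv]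
  simp

theorem isFiberedDiffeo_of_tangent {Φ : Triple} (hΦ : ∀ i, Φ i - X i ∈ orderIdeal 2)
    (hΦ0 : Φ 0 = X 0) : IsFiberedDiffeo Φ := by
  refine ⟨⟨fun i => mem_orderIdeal_one.1 (mem_orderIdeal_one_of_tangent hΦ i), ?_⟩, hΦ0⟩
  have : linearPart Φ = 1 := by
    ext i j
    have h := hΦ i (single j 1) (by simp)
    rw [map_sub, sub_eq_zero] at h
    classical
    rw [linearPart_apply, h, coeff_index_single_X, Matrix.one_apply]
    simp [eq_comm]
  rw [this]
  exact isUnit_one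

/-- The `x`-component of a doubly-resonant saddle-node is `x²`. -/
theorem IsDoublyResonantSaddleNode.apply_zero {Y : Triple} (hY : IsDoublyResonantSaddleNode Y) :
    Y 0 = X 0 ^ 2 := by
  obtain ⟨_, Z, ⟨l, F₁, F₂, _, _, _, rfl⟩, Φ, ⟨⟨hv, _⟩, hΦ0⟩, hp⟩ := hY
  have h := hp 0
  have hs : HasSubst Φ := hasSubst_of_constantCoeff_zero hv
  simp only [Matrix.cons_val_zero] at h
  rw [subst_pow hs, subst_X hs, hΦ0, Fin.sum_univ_three, pderiv_X_self,
      pderiv_X_of_ne (by decide), pderiv_X_of_ne (by decide)] at h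
  rw [← h]
  ring

theorem eq_zero_or_single_of_degree_lt_two {m : Fin 3 →₀ ℕ} (hm : degree m < 2) :
    m = 0 ∨ ∃ j, m = single j 1 := by
  rcases Nat.lt_or_ge (degree m) 1 with h | h
  · left
    rw [← degree_eq_zero_iff]
    omega
  · right
    rw [degree_eq] at hm h
    by_cases h0 : m 0 = 1
    · exact ⟨0, by ext j; fin_cases j <;> simp <;> omega⟩
    by_cases h1 : m 1 = 1
    · exact ⟨1, by ext j; fin_cases j <;> simp <;> omega⟩
    · exact ⟨2, by ext j; fin_cases j <;> simp <;> omega⟩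

theorem sub_linear_mem_orderIdeal {Y : Triple} {l : ℂ} (hv : VanishesAtOrigin Y)
    (hD : linearPart Y = Matrix.diagonal ![0, -l, l]) (i : Fin 3) :
    Y i - C (l * wt i) * X i ∈ orderIdeal 2 := by
  classical
  intro m hm
  rcases eq_zero_or_single_of_degree_lt_two hm with rfl | ⟨j, rfl⟩
  · rw [coeff_zero_eq_constantCoeff_apply, map_sub, hv i]
    simp
  · rw [map_sub, ← linearPart_apply, hD, coeff_C_mul, coeff_index_single_X]
    fin_cases i <;> fin_cases j <;> simp [wt]

theorem isPrepared_of_linearPart {Y : Triple} {l : ℂ} (hl : l ≠ 0) (hv : VanishesAtOrigin Y)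
    (hY0 : Y 0 = X 0 ^ 2) (hD : linearPart Y = Matrix.diagonal ![0, -l, l]) : IsPrepared Y := by
  have h := sub_linear_mem_orderIdeal hv hD
  refine ⟨l, _, _, hl, mem_orderIdeal_iff_le_order.1 (h 1),
    mem_orderIdeal_iff_le_order.1 (h 2), ?_⟩
  funext i
  fin_cases i
  · exact hY0
  · simp [wt]
  · simp [wt]

/-- The coefficients of `x Xᵢ` in the components of `Y`. -/
def resonantCoeff (Y : Triple) (i : Fin 3) : ℂ := coeff (single i 1 + single 0 1) (Y i)

theorem traceCoeff_eq (Y : Triple) : traceCoeff Y = resonantCoeff Y 1 + resonantCoeff Y 2 := by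
  rw [traceCoeff, map_add, coeff_pderiv, coeff_pderiv, resonantCoeff, resonantCoeff,
    add_comm (single 1 1), add_comm (single 2 1)]
  simp

/-- The only quadratic monomial with the weight of yᵢ is x yᵢ, and its coefficient has been split
off. In the x-component the remainder is zero because Y₀ = x². -/
theorem hasResonantPart_of_linearPart {Y : Triple} {l : ℂ} (hv : VanishesAtOrigin Y)
    (hY0 : Y 0 = X 0 ^ 2) (hD : linearPart Y = Matrix.diagonal ![0, -l, l]) :
    HasResonantPart Y l ![1, resonantCoeff Y 1, resonantCoeff Y 2] := by
  classical
  refine ⟨fun i => Y i - C (l * wt i) * X i -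
    C ((![1, resonantCoeff Y 1, resonantCoeff Y 2] : Fin 3 → ℂ) i) * (X 0 * X i),
    fun i => by ring, fun i m hm => ?_⟩
  have h2 : ∀ i, C ((![1, resonantCoeff Y 1, resonantCoeff Y 2] : Fin 3 → ℂ) i) * (X 0 * X i) ∈
    orderIdeal 2 := fun i => Ideal.mul_mem_left _ _
      (mul_mem_orderIdeal (X_mem_orderIdeal 0) (X_mem_orderIdeal i))
  have h3 := sub_mem (sub_linear_mem_orderIdeal hv hD i) (h2 i)
  refine ⟨le_of_not_gt fun h => hm (h3 m h), fun hd hw => hm ?_⟩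
  by_cases hi : i = 0
  · subst hi
    simp [hY0, wt, pow_two]
  · have hm' : m = single i 1 + single 0 1 := by
      rw [degree_eq] at hd
      have hi' : i = 1 ∨ i = 2 := by fin_cases i <;> simp at hi ⊢
      rcases hi' with rfl | rfl <;> simp [weight, wt] at hw <;> ext j <;> fin_cases j <;>
        simp <;> omega
    have h4 : coeff (single i 1 + single 0 1) (X i : Series) = 0 := by
      rw [coeff_X, if_neg]
      intro h
      have := congrArg degree h
      simp at this
    rw [hm', map_sub, map_sub, coeff_C_mul, coeff_C_mul, h4, coeff_add_single_X_mul,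
      coeff_index_single_self_X]
    fin_cases i
    · exact absurd rfl hi
    · simp [resonantCoeff]
    · simp [resonantCoeff]

end SaddleNode

end

theorem mainTheorem7 (Y : SaddleNode.Triple) (l : ℂ)
    (hY : SaddleNode.IsNonDegenerate Y) (hl : l ≠ 0)
    (hD : SaddleNode.linearPart Y = Matrix.diagonal ![0, -l, l]) :
    ∃! Φ : SaddleNode.Triple,
      SaddleNode.IsFiberedDiffeo Φ ∧ SaddleNode.IsTangentToId Φ ∧
      ∃ (a₁ a₂ : ℂ) (c₁ c₂ : PowerSeries ℂ),
        PowerSeries.constantCoeff c₁ = 0 ∧ PowerSeries.constantCoeff c₂ = 0 ∧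
        a₁ + a₂ = SaddleNode.residue Y ∧
        SaddleNode.PushesForwardTo Φ Y (SaddleNode.normalForm l a₁ a₂ c₁ c₂) := by
  open SaddleNode in
  obtain ⟨hS, hres⟩ := hY
  have hv := hS.1
  have hY0 := hS.apply_zero
  have hR := hasResonantPart_of_linearPart hv hY0 hD
  have hresidue : residue Y = resonantCoeff Y 1 + resonantCoeff Y 2 := by
    -- Y is itself prepared, so its residue is read from Y directly, with no choice of a conjugate.
    rw [residue, if_pos (isPrepared_of_linearPart hl hv hY0 hD), traceCoeff_eq]
  rw [hresidue] at hres
  obtain ⟨u, hu, huniq⟩ := existsUnique_system hl hR rfl hres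
  refine ⟨toMap u, ⟨isFiberedDiffeo_of_tangent (toMap_sub_X_mem u) (toMap_zero u),
    isTangentToId_iff.2 (toMap_sub_X_mem u), resonantCoeff Y 1, resonantCoeff Y 2,
    toSeries u 1, toSeries u 2, constantCoeff_toSeries u 1, constantCoeff_toSeries u 2,
    hresidue.symm, ?_⟩, ?_⟩
  · rw [pushesForwardTo_normalForm_iff hY0 (toMap_sub_X_mem u) (toMap_zero u)]
    intro i hi
    have h := defect_eq_zero_of_system hR hu hi
    have hc : (![0, toSeries u 1, toSeries u 2] : Fin 3 → PowerSeries ℂ) i = toSeries u i := by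
      fin_cases i
      · exact absurd rfl hi
      · rfl
      · rfl
    rw [defect] at h ⊢
    rw [hc, h]
  · rintro Φ ⟨hF, hT, a₁, a₂, c₁, c₂, hc₁, hc₂, -, hP⟩
    rw [isTangentToId_iff] at hT
    rw [pushesForwardTo_normalForm_iff hY0 hT hF.2] at hP
    have hc : ∀ i, PowerSeries.constantCoeff ((![0, c₁, c₂] : Fin 3 → PowerSeries ℂ) i) = 0 := by
      intro i
      fin_cases i
      · simp
      · exact hc₁
      · exact hc₂
    -- Once a₁ and a₂ are known to be forced, every competing Φ comes from a solution of the same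
    -- system.
    have h₁ : a₁ = resonantCoeff Y 1 := eq_of_defect_eq_zero hR hT (hc 1) (hP 1 (by decide))
    have h₂ : a₂ = resonantCoeff Y 2 := eq_of_defect_eq_zero hR hT (hc 2) (hP 2 (by decide))
    subst h₁ h₂
    obtain ⟨w, hw, rfl⟩ := exists_system_of_defect_eq_zero hT hF.2 hc hP
    rw [huniq w hw]
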